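/- For $a,b\in\overline{\mathbb R}=[-\infty,+\infty]$ let $S_{a,b}=\{z\in\mathbb C: a<\operatorname{Im} z<b\}$. A function $G:(a,b)\to\mathbb C$ is co-positive definite if, for every $n\in\mathbb N$, all $x_1,\dots,x_n\in\mathbb R$ with $x_k+x_l\in(a,b)$ for all $k,l$, and all $\xi_1,\dots,\xi_n\in\mathbb C$, the number $\sum_{k,l=1}^n G(x_k+x_l)\,\xi_k\overline{\xi_l}$ is real and nonnegative. A function $f$ is positive definite on a set $S\subset\mathbb C$ if, for every $n\in\mathbb N$, all $z_1,\dots,z_n\in\mathbb C$ with $z_k-\overline{z_l}\in S$ for all $k,l$, and all $\xi_1,\dots,\xi_n\in\mathbb C$, the number $\sum_{k,l=1}^n f(z_k-\overline{z_l})\,\xi_k\overline{\xi_l}$ is real and nonnegative. **Theorem.** Let $f$ be meromorphic on $\mathbb C$ and let $a,b\in\overline{\mathbb R}$ with $a<b$. Suppose that $G(y)=f(iy)$ is co-positive definite on $(a,b)$. Then there are $c,d\in\overline{\mathbb R}$ such that $S_{c,d}$ contains $S_{a,b}$, $f$ is holomorphic and positive definite on $S_{c,d}$, and $S_{c,d}$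 is maximal: every horizontal strip $S_{c',d'}$ (with $c',d'\in\overline{\mathbb R}$) that contains $S_{a,b}$ and on which $f$ is holomorphic is contained in $S_{c,d}$. Moreover, if $c$ is finite then $ic$ is a pole of $f$, and if $d$ is finite then $id$ is a pole of $f$. -/

import Mathlib

open scoped ComplexOrder ComplexConjugate

/-- The open interval `(a, b)` of real numbers, with extended real end points. -/
def realInterval (a b : EReal) : Set ℝ :=
  {y : ℝ | a < (y : EReal) ∧ (y : EReal) < b}

/-- The horizontal strip `S_{a,b} = {z ∈ ℂ : a < Im z < b}`, with extended real `a`, `b`. -/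
def horizontalStrip (a b : EReal) : Set ℂ :=
  {z : ℂ | a < (z.im : EReal) ∧ (z.im : EReal) < b}

/-- `G` is co-positive definite on `J ⊆ ℝ`. The order on `ℂ` is the usual partial order:
`0 ≤ w` says that `w` is real and nonnegative. -/
def CoPositiveDefiniteOn (G : ℝ → ℂ) (J : Set ℝ) : Prop :=
  ∀ (n : ℕ) (x : Fin n → ℝ), (∀ k l, x k + x l ∈ J) →
    ∀ ξ : Fin n → ℂ, 0 ≤ ∑ k, ∑ l, G (x k + x l) * ξ k * conj (ξ l)

/-- `f` is positive definite in `S ⊆ ℂ`. -/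
def PositiveDefiniteOn (f : ℂ → ℂ) (S : Set ℂ) : Prop :=
  ∀ (n : ℕ) (z : Fin n → ℂ), (∀ k l, z k - conj (z l) ∈ S) →
    ∀ ξ : Fin n → ℂ, 0 ≤ ∑ k, ∑ l, f (z k - conj (z l)) * ξ k * conj (ξ l)

/-- `p` is a pole of `f`: the Laurent expansion of `f` at `p` starts at a negative order. -/
def IsPoleAt (f : ℂ → ℂ) (p : ℂ) : Prop :=
  MeromorphicAt f p ∧ meromorphicOrderAt f p < 0

/-- `f` is a meromorphic function on `ℂ`: it is holomorphic away from its poles. As Lean functions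
are total, `f` also has a value at each pole; nothing is required of that value. -/
def IsMeromorphicFunction (f : ℂ → ℂ) : Prop :=
  Meromorphic f ∧ ∀ z : ℂ, ¬ IsPoleAt f z → AnalyticAt ℂ f z

/-- `S_{c,d}` is the maximal horizontal strip that contains `S_{a,b}` and on which `f` is
holomorphic. -/
def IsMaximalHolomorphicStrip (f : ℂ → ℂ) (a b c d : EReal) : Prop :=
  horizontalStrip a b ⊆ horizontalStrip c d ∧
  DifferentiableOn ℂ f (horizontalStrip c d) ∧
  ∀ c' d' : EReal, horizontalStrip a b ⊆ horizontalStrip c' d' →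
    DifferentiableOn ℂ f (horizontalStrip c' d') →
      horizontalStrip c' d' ⊆ horizontalStrip c d

open Filter Topology Asymptotics

/-! Put F(w) = f(iw). Strips become vertical, and hypothesis and conclusion both concern positivity
of the kernel F(w + conj v). Its two-point case, 2|F(c + conj c')| ≤ Re F(c + conj c) + Re F(c' +
conj c'), rules out poles of F on the given real segment.

Forward differences turn positivity of the kernel into positivity of its jets, the forms with
entries F^(i+j)(c_k + conj c_l) (`PositiveDefiniteKernelOn.iteratedDeriv_nonneg`). Summing Taylor
series then carries positivity to a neighbourhood, given analyticity on large enough balls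
(`PositiveDefiniteKernelOn.extend`). Uniform Taylor bounds on a compact real segment let this
propagate along the real axis as far as F stays analytic there
(`PositiveDefiniteKernelOn.extend_real`).

To leave the axis (`PositiveDefiniteKernelOn.extend_strip`), write p = p/2 + conj(conj p/2). Jet
positivity bounds the derivatives at p by those at Re p, so the Taylor radius at p is bounded below
independently of Im p. A meromorphic function has no pole inside the disc of convergence of its
Taylor series (`analyticAt_of_norm_iteratedDeriv_le`), so steps of fixed size reach every height.
The maximal strip is therefore cut out by the nearest singularities of f on the imaginary axis. -/

/-! ### Derivatives as limits of forward differences. -/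

theorem sum_neg_one_pow_choose_mul_pow (n q : ℕ) (hq : q ≤ n) :
    ∑ m ∈ Finset.range (n + 1), (((-1 : ℤ) ^ (n - m) * n.choose m : ℤ) : ℂ) * (m : ℂ) ^ q =
      if q = n then (n.factorial : ℂ) else 0 := by
  have h := fwdDiff_iter_eq_sum_shift (1 : ℂ) (fun r : ℂ => r ^ q) n 0
  have h' : ∑ m ∈ Finset.range (n + 1),
      (((-1 : ℤ) ^ (n - m) * n.choose m : ℤ) : ℂ) * (m : ℂ) ^ q =
      ((fwdDiff (1 : ℂ))^[n] fun r : ℂ => r ^ q) 0 := by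
    rw [h]
    refine Finset.sum_congr rfl fun m _ => ?_
    rw [zsmul_eq_mul]
    simp
  rw [h']
  split_ifs with hqn
  · subst hqn
    rw [fwdDiff_iter_eq_factorial]
    simp
  · rw [fwdDiff_iter_pow_eq_zero_of_lt (lt_of_le_of_ne hq hqn)]
    simp

theorem AnalyticAt.taylor_isBigO {F : ℂ → ℂ} {p : ℂ} (hF : AnalyticAt ℂ F p) (n : ℕ) :
    (fun z : ℂ => F (p + z) -
      ∑ q ∈ Finset.range n, iteratedDeriv q F p / q.factorial * z ^ q)
      =O[𝓝 0] fun z => ‖z‖ ^ n := by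
  have h := hF.hasFPowerSeriesAt.isBigO_sub_partialSum_pow n
  refine h.congr_left fun z => ?_
  congr 1
  simp only [FormalMultilinearSeries.partialSum]
  refine Finset.sum_congr rfl fun q _ => ?_
  simp [mul_comm]

/-- The rescaled iterated forward differences of an analytic function tend to its derivatives. -/
theorem AnalyticAt.tendsto_fwdDiff_iter_div_pow {F : ℂ → ℂ} {p : ℂ} (hF : AnalyticAt ℂ F p)
    (n : ℕ) :
    Tendsto (fun ε : ℂ => ((fwdDiff ε)^[n] F) p / ε ^ n) (𝓝[≠] 0) (𝓝 (iteratedDeriv n F p)) := by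
  set a : ℕ → ℂ := fun q => iteratedDeriv q F p / q.factorial with ha
  set b : ℕ → ℂ := fun m => (((-1 : ℤ) ^ (n - m) * n.choose m : ℤ) : ℂ) with hb
  have hR := hF.taylor_isBigO (n + 1)
  have key : (fun ε : ℂ => ((fwdDiff ε)^[n] F) p - iteratedDeriv n F p * ε ^ n)
      =O[𝓝 0] fun ε => ‖ε‖ ^ (n + 1) := by
    -- Replacing each sample by its Taylor polynomial of degree n costs O(ε^(n+1)); the n-th
    -- difference of that polynomial keeps only its top term.
    have h1 : (fun ε : ℂ => ∑ m ∈ Finset.range (n + 1), b m *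
        (F (p + m * ε) - ∑ q ∈ Finset.range (n + 1), a q * (m * ε) ^ q))
        =O[𝓝 0] fun ε => ‖ε‖ ^ (n + 1) := by
      refine IsBigO.fun_sum fun m _ => ?_
      refine IsBigO.const_mul_left ?_ _
      have ht : Tendsto (fun ε : ℂ => (m : ℂ) * ε) (𝓝 0) (𝓝 0) := by
        simpa using (continuous_const_mul (m : ℂ)).tendsto 0
      refine (hR.comp_tendsto ht).trans ?_
      refine IsBigO.of_bound (‖(m : ℂ)‖ ^ (n + 1)) (Eventually.of_forall fun ε => ?_)
      simp [mul_pow]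
    refine h1.congr_left fun ε => ?_
    rw [fwdDiff_iter_eq_sum_shift]
    simp only [mul_sub, Finset.sum_sub_distrib]
    congr 1
    · refine Finset.sum_congr rfl fun m _ => ?_
      rw [zsmul_eq_mul, nsmul_eq_mul]
    · simp only [Finset.mul_sum]
      rw [Finset.sum_comm]
      have : ∀ q ∈ Finset.range (n + 1),
          ∑ m ∈ Finset.range (n + 1), b m * (a q * (m * ε) ^ q) =
            if q = n then iteratedDeriv n F p * ε ^ n else 0 := by
        intro q hq
        have hs := sum_neg_one_pow_choose_mul_pow n q
          (Nat.lt_succ_iff.mp (Finset.mem_range.mp hq))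
        calc _ = a q * ε ^ q * ∑ m ∈ Finset.range (n + 1), b m * (m : ℂ) ^ q := by
              rw [Finset.mul_sum]
              exact Finset.sum_congr rfl fun m _ => by ring
          _ = _ := by
              rw [hs]
              split_ifs with h
              · subst h
                have : (q.factorial : ℂ) ≠ 0 := by exact_mod_cast q.factorial_ne_zero
                simp only [ha]
                field_simp
              · simp
      rw [Finset.sum_congr rfl this]
      simp
  have h2 : (fun ε : ℂ => ((fwdDiff ε)^[n] F) p - iteratedDeriv n F p * ε ^ n)
      =o[𝓝[≠] 0] fun ε => ε ^ n := by
    refine (key.mono nhdsWithin_le_nhds).trans_isLittleO ?_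
    refine IsLittleO.mono ?_ nhdsWithin_le_nhds
    have := (isLittleO_pow_pow (𝕜 := ℂ) (Nat.lt_succ_self n)).norm_left
    simpa using this
  have h3 := h2.tendsto_div_nhds_zero
  have h4 := h3.add_const (iteratedDeriv n F p)
  rw [zero_add] at h4
  refine h4.congr' ?_
  filter_upwards [self_mem_nhdsWithin] with ε hε
  have : ε ≠ 0 := hε
  field_simp
  ring

/-! ### Positive definite kernels, their jets and Taylor extension. -/

/-- The kernel `(w, v) ↦ F (w + conj v)` is positive definite on `Ω`. -/
def PositiveDefiniteKernelOn (F : ℂ → ℂ) (Ω : Set ℂ) : Prop :=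
  ∀ (ι : Type) [Fintype ι] (w : ι → ℂ), (∀ k, w k ∈ Ω) →
    ∀ ξ : ι → ℂ, 0 ≤ ∑ k, ∑ l, F (w k + conj (w l)) * ξ k * conj (ξ l)

/-- The i differences act on one kernel variable and the j on the other. Binomials vanish beyond
their order, so all orders below N can share the same sample points. -/
theorem fwdDiff_iter_add_eq_sum_sum (F : ℂ → ℂ) (ε p : ℂ) (i j N : ℕ) (hi : i < N) (hj : j < N) :
    ((fwdDiff ε)^[i + j] F) p = ∑ m ∈ Finset.range N, ∑ m' ∈ Finset.range N,
      (((-1 : ℤ) ^ (i - m) * i.choose m : ℤ) : ℂ) * (((-1 : ℤ) ^ (j - m') * j.choose m' : ℤ) : ℂ) *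
        F (p + (m + m') * ε) := by
  have ext : ∀ (n : ℕ) (g : ℂ → ℂ) (y : ℂ), n < N → ((fwdDiff ε)^[n] g) y =
      ∑ m ∈ Finset.range N, (((-1 : ℤ) ^ (n - m) * n.choose m : ℤ) : ℂ) * g (y + m * ε) := by
    intro n g y hn
    rw [fwdDiff_iter_eq_sum_shift]
    have hsub : Finset.range (n + 1) ⊆ Finset.range N := Finset.range_subset_range.mpr hn
    rw [← Finset.sum_subset hsub]
    · exact Finset.sum_congr rfl fun m _ => by rw [zsmul_eq_mul, nsmul_eq_mul]
    · intro m _ hm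
      rw [Nat.choose_eq_zero_of_lt (by simpa using hm)]
      simp
  rw [Function.iterate_add_apply, ext i _ _ hi]
  refine Finset.sum_congr rfl fun m _ => ?_
  rw [ext j _ _ hj, Finset.mul_sum]
  refine Finset.sum_congr rfl fun m' _ => ?_
  rw [show p + m * ε + m' * ε = p + (m + m') * ε by ring]
  ring

/-- A positive definite kernel has positive definite jets. -/
theorem PositiveDefiniteKernelOn.iteratedDeriv_nonneg {F : ℂ → ℂ} {Ω : Set ℂ}
    (hF : PositiveDefiniteKernelOn F Ω)
    (hΩ : ∀ c ∈ Ω, ∀ᶠ ε : ℝ in 𝓝 0, c + ε ∈ Ω)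
    (hA : ∀ c ∈ Ω, ∀ c' ∈ Ω, AnalyticAt ℂ F (c + conj c'))
    {ι : Type} [Fintype ι] (c : ι → ℂ) (hc : ∀ k, c k ∈ Ω) (N : ℕ) (ζ : ι → Fin N → ℂ) :
    0 ≤ ∑ k, ∑ l, ∑ i : Fin N, ∑ j : Fin N,
      iteratedDeriv (i + j) F (c k + conj (c l)) * ζ k i * conj (ζ l j) := by
  set b : ℕ → ℕ → ℂ := fun n m => (((-1 : ℤ) ^ (n - m) * n.choose m : ℤ) : ℂ) with hb
  have hbc : ∀ n m, conj (b n m) = b n m := fun n m => by simp only [hb, map_intCast]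
  have hlim : Tendsto (fun ε : ℝ => ∑ k, ∑ l, ∑ i : Fin N, ∑ j : Fin N,
      ((fwdDiff (ε : ℂ))^[(i + j : ℕ)] F) (c k + conj (c l)) / (ε : ℂ) ^ (i + j : ℕ)
        * ζ k i * conj (ζ l j)) (𝓝[≠] 0)
      (𝓝 (∑ k, ∑ l, ∑ i : Fin N, ∑ j : Fin N,
      iteratedDeriv (i + j) F (c k + conj (c l)) * ζ k i * conj (ζ l j))) := by
    have hof : Tendsto (fun ε : ℝ => (ε : ℂ)) (𝓝[≠] 0) (𝓝[≠] 0) := by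
      refine tendsto_nhdsWithin_iff.mpr ⟨?_, ?_⟩
      · exact (Complex.continuous_ofReal.tendsto' 0 0 (by simp)).mono_left nhdsWithin_le_nhds
      · filter_upwards [self_mem_nhdsWithin] with ε hε
        simpa using hε
    refine tendsto_finsetSum _ fun k _ => tendsto_finsetSum _ fun l _ =>
      tendsto_finsetSum _ fun i _ => tendsto_finsetSum _ fun j _ => ?_
    refine Tendsto.mul_const _ (Tendsto.mul_const _ ?_)
    exact ((hA _ (hc k) _ (hc l)).tendsto_fwdDiff_iter_div_pow _).comp hof
  refine ge_of_tendsto hlim ?_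
  have hmem : ∀ᶠ ε : ℝ in 𝓝[≠] 0, ∀ (k : ι) (m : Fin N), c k + (m : ℂ) * (ε : ℂ) ∈ Ω := by
    refine nhdsWithin_le_nhds ?_
    refine eventually_all.mpr fun k => eventually_all.mpr fun m => ?_
    have ht : Tendsto (fun ε : ℝ => (m : ℝ) * ε) (𝓝 0) (𝓝 0) := by
      simpa using (continuous_const_mul (m : ℝ)).tendsto 0
    filter_upwards [ht.eventually (hΩ _ (hc k))] with ε hε
    simpa using hε
  filter_upwards [hmem] with ε hε
  -- Test the kernel at the samples c_k + mε, with the difference coefficients absorbed into the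
  -- weights. As ε is real, conjugation leaves the shifts and the divisors unchanged.
  have := hF (ι × Fin N) (fun x => c x.1 + (x.2 : ℂ) * (ε : ℂ)) (fun x => hε x.1 x.2)
    (fun x => ∑ i : Fin N, ζ x.1 i / (ε : ℂ) ^ (i : ℕ) * b i x.2)
  refine this.trans_eq ?_
  rw [Fintype.sum_prod_type]
  simp only [Fintype.sum_prod_type]
  refine Finset.sum_congr rfl fun k _ => ?_
  rw [Finset.sum_comm]
  refine Finset.sum_congr rfl fun l _ => ?_
  have e1 : ∀ i j : Fin N, ((fwdDiff (ε : ℂ))^[(i + j : ℕ)] F) (c k + conj (c l)) =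
      ∑ m : Fin N, ∑ m' : Fin N, b i m * b j m' *
        F (c k + conj (c l) + ((m : ℕ) + (m' : ℕ)) * (ε : ℂ)) := by
    intro i j
    rw [fwdDiff_iter_add_eq_sum_sum F ε _ i j N i.2 j.2, Finset.sum_range]
    exact Finset.sum_congr rfl fun m _ => by rw [Finset.sum_range]
  have e2 : ∀ m m' : Fin N, c k + (m : ℕ) * (ε : ℂ) + conj (c l + (m' : ℕ) * (ε : ℂ)) =
      c k + conj (c l) + ((m : ℕ) + (m' : ℕ)) * (ε : ℂ) := by
    intro m m'
    simp only [map_add, map_mul, Complex.conj_ofReal, Complex.conj_natCast]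
    ring
  have e3 : ∀ T : Fin N → Fin N → Fin N → Fin N → ℂ,
      ∑ i, ∑ j, ∑ m, ∑ m', T i j m m' = ∑ m, ∑ m', ∑ i, ∑ j, T i j m m' := by
    intro T
    have := Finset.sum_comm (s := Finset.univ) (t := Finset.univ)
      (f := fun (x y : Fin N × Fin N) => T x.1 x.2 y.1 y.2)
    simpa only [Fintype.sum_prod_type] using this
  simp only [e1, Finset.sum_mul, Finset.sum_div]
  rw [e3]
  refine Finset.sum_congr rfl fun m _ => Finset.sum_congr rfl fun m' _ => ?_
  simp only [e2]
  rw [mul_assoc, map_sum, Finset.sum_mul_sum, Finset.mul_sum]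
  refine Finset.sum_congr rfl fun i _ => ?_
  rw [Finset.mul_sum]
  refine Finset.sum_congr rfl fun j _ => ?_
  simp only [map_mul, map_div₀, map_pow, Complex.conj_ofReal, hbc, pow_add]
  rw [mul_comm (ε ^ (i : ℕ) : ℂ)]
  field_simp

/-- The Taylor expansion of `F (p + u + v)` as a double series in `u` and `v`. -/
theorem hasSum_taylorSeries_add {F : ℂ → ℂ} {p u v : ℂ} {R : ℝ}
    (hF : DifferentiableOn ℂ F (Metric.ball p R)) (huv : ‖u‖ + ‖v‖ < R) :
    HasSum (fun x : ℕ × ℕ => iteratedDeriv (x.1 + x.2) F p *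
      (u ^ x.1 / x.1.factorial) * (v ^ x.2 / x.2.factorial)) (F (p + u + v)) := by
  set T : ℂ → ℂ → ℕ × ℕ → ℂ := fun u v x => iteratedDeriv (x.1 + x.2) F p *
      (u ^ x.1 / x.1.factorial) * (v ^ x.2 / x.2.factorial) with hT
  have hanti : ∀ (a b : ℂ) (n : ℕ), ∑ x ∈ Finset.HasAntidiagonal.antidiagonal n, (a ^ x.1 / x.1.factorial) *
      (b ^ x.2 / x.2.factorial) = (a + b) ^ n / n.factorial := by
    intro a b n
    rw [(Commute.all a b).add_pow', Finset.sum_div]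
    refine Finset.sum_congr rfl fun x hx => ?_
    have hx' : x.1 + x.2 = n := by simpa using hx
    have h0 : (n.factorial : ℂ) ≠ 0 := by exact_mod_cast n.factorial_ne_zero
    have h1 : (x.1.factorial : ℂ) ≠ 0 := by exact_mod_cast x.1.factorial_ne_zero
    have h2 : (x.2.factorial : ℂ) ≠ 0 := by exact_mod_cast x.2.factorial_ne_zero
    have h3 : ((n.choose x.1 : ℕ) : ℂ) * x.1.factorial * x.2.factorial = n.factorial := by
      have := Nat.choose_mul_factorial_mul_factorial (n := n) (k := x.1) (by omega)
      rw [show n - x.1 = x.2 by omega] at this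
      exact_mod_cast this
    rw [nsmul_eq_mul, ← h3]
    have h4 : ((n.choose x.1 : ℕ) : ℂ) ≠ 0 := by
      intro h
      rw [h] at h3
      simp at h3
      exact h0 h3.symm
    field_simp
  have hsum : ∀ (a b : ℂ) (n : ℕ), ∑ x ∈ Finset.HasAntidiagonal.antidiagonal n, T a b x =
      (n.factorial : ℂ)⁻¹ • (p + (a + b) - p) ^ n • iteratedDeriv n F p := by
    intro a b n
    have : ∀ x ∈ Finset.HasAntidiagonal.antidiagonal n, T a b x = iteratedDeriv n F p *
        ((a ^ x.1 / x.1.factorial) * (b ^ x.2 / x.2.factorial)) := by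
      intro x hx
      have hx' : x.1 + x.2 = n := by simpa using hx
      simp only [hT, hx', mul_assoc]
    rw [Finset.sum_congr rfl this, ← Finset.mul_sum, hanti]
    simp only [smul_eq_mul, add_sub_cancel_left]
    ring
  have hsummable : Summable (T u v) := by
    rw [← Finset.HasAntidiagonal.sigmaAntidiagonalEquivProd.summable_iff]
    refine Summable.of_norm ?_
    rw [summable_sigma_of_nonneg fun _ => norm_nonneg _]
    refine ⟨fun n => (hasSum_fintype _).summable, ?_⟩
    -- Absolute convergence: the norms on each antidiagonal add up to a term of the Taylor series at
    -- p + ‖u‖ + ‖v‖, still inside the ball.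
    have hz : p + ((‖u‖ : ℂ) + (‖v‖ : ℂ)) ∈ Metric.ball p R := by
      rw [mem_ball_iff_norm, add_sub_cancel_left, ← Complex.ofReal_add, Complex.norm_real,
        Real.norm_of_nonneg (by positivity)]
      exact huv
    have h := (Complex.hasSum_taylorSeries_on_ball hF hz).summable.norm
    refine h.congr fun n => ?_
    rw [tsum_fintype, Finset.univ_eq_attach]
    have := Finset.sum_attach (Finset.HasAntidiagonal.antidiagonal n) fun x => ‖T u v x‖
    refine Eq.trans ?_ this.symm
    have e : ∀ x ∈ Finset.HasAntidiagonal.antidiagonal n, ‖T u v x‖ = ‖iteratedDeriv n F p‖ *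
        ((‖u‖ ^ x.1 / x.1.factorial) * (‖v‖ ^ x.2 / x.2.factorial)) := by
      intro x hx
      have hx' : x.1 + x.2 = n := by simpa using hx
      simp only [hT, hx', mul_assoc, norm_mul, norm_div, norm_pow, Complex.norm_natCast]
    rw [Finset.sum_congr rfl e, ← Finset.mul_sum]
    have h5 : ∑ x ∈ Finset.HasAntidiagonal.antidiagonal n, (‖u‖ ^ x.1 / x.1.factorial) *
      (‖v‖ ^ x.2 / x.2.factorial) = (‖u‖ + ‖v‖) ^ n / n.factorial := by
      exact_mod_cast hanti ‖u‖ ‖v‖ n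
    rw [h5]
    simp only [add_sub_cancel_left, norm_smul, norm_pow, norm_inv, Complex.norm_natCast,
      ← Complex.ofReal_add, Complex.norm_real,
      Real.norm_of_nonneg (add_nonneg (norm_nonneg u) (norm_nonneg v))]
    ring
  have hz : p + (u + v) ∈ Metric.ball p R := by
    rw [mem_ball_iff_norm, add_sub_cancel_left]
    exact (norm_add_le _ _).trans_lt huv
  have h1 := Complex.hasSum_taylorSeries_on_ball hF hz
  have h2 := hsummable.hasSum
  rw [← Finset.HasAntidiagonal.sigmaAntidiagonalEquivProd.hasSum_iff] at h2
  have h3 := h2.sigma fun n => hasSum_fintype _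
  have h4 : HasSum (fun n : ℕ => (n.factorial : ℂ)⁻¹ • (p + (u + v) - p) ^ n •
      iteratedDeriv n F p) (∑' x, T u v x) := by
    convert h3 using 1
    funext n
    rw [← hsum, Finset.univ_eq_attach]
    exact (Finset.sum_attach (Finset.HasAntidiagonal.antidiagonal n) fun x => T u v x).symm
  have h5 := h1.unique h4
  rw [add_assoc, h5]
  exact hsummable.hasSum

/-- A positive definite kernel extends along Taylor expansions. -/
theorem PositiveDefiniteKernelOn.extend {F : ℂ → ℂ} {Ω : Set ℂ}
    (hF : PositiveDefiniteKernelOn F Ω)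
    (hΩ : ∀ c ∈ Ω, ∀ᶠ ε : ℝ in 𝓝 0, c + ε ∈ Ω) {r : ℝ} (hr : 0 < r)
    (hA : ∀ c ∈ Ω, ∀ c' ∈ Ω, ∀ z ∈ Metric.ball (c + conj c') (2 * r), AnalyticAt ℂ F z) :
    PositiveDefiniteKernelOn F (Metric.thickening r Ω) := by
  intro ι _ w hw ξ
  choose c hc hcw using fun k => Metric.mem_thickening_iff.mp (hw k)
  have hA' : ∀ c ∈ Ω, ∀ c' ∈ Ω, AnalyticAt ℂ F (c + conj c') := fun c hc c' hc' =>
    hA c hc c' hc' _ (Metric.mem_ball_self (by positivity))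
  have hlim : Tendsto (fun N : ℕ => ∑ k, ∑ l,
      (∑ x ∈ Finset.range N ×ˢ Finset.range N, iteratedDeriv (x.1 + x.2) F (c k + conj (c l)) *
        ((w k - c k) ^ x.1 / x.1.factorial) * (conj (w l - c l) ^ x.2 / x.2.factorial))
        * ξ k * conj (ξ l)) atTop
      (𝓝 (∑ k, ∑ l, F (w k + conj (w l)) * ξ k * conj (ξ l))) := by
    refine tendsto_finsetSum _ fun k _ => tendsto_finsetSum _ fun l _ => ?_
    refine Tendsto.mul_const _ (Tendsto.mul_const _ ?_)
    have hd : DifferentiableOn ℂ F (Metric.ball (c k + conj (c l)) (2 * r)) := fun z hz =>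
      (hA _ (hc k) _ (hc l) z hz).differentiableAt.differentiableWithinAt
    have h := hasSum_taylorSeries_add (u := w k - c k) (v := conj (w l - c l)) hd (by
      rw [RCLike.norm_conj, ← dist_eq_norm, ← dist_eq_norm]
      linarith [hcw k, hcw l])
    rw [show c k + conj (c l) + (w k - c k) + conj (w l - c l) = w k + conj (w l) by
      rw [map_sub]; ring] at h
    have hrange : Tendsto (fun N => Finset.range N ×ˢ Finset.range N) atTop
        (atTop : Filter (Finset (ℕ × ℕ))) := by
      refine tendsto_atTop_finset_of_monotone (fun M N hMN => ?_) fun x => ?_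
      · exact Finset.product_subset_product (Finset.range_mono hMN) (Finset.range_mono hMN)
      · refine ⟨x.1 + x.2 + 1, Finset.mem_product.mpr ⟨?_, ?_⟩⟩ <;> rw [Finset.mem_range] <;> omega
    rw [HasSum, SummationFilter.unconditional_filter] at h
    exact h.comp hrange
  -- A square truncation of the double series is a jet form, with the Taylor monomials absorbed into
  -- the weights.
  refine ge_of_tendsto' hlim fun N => ?_
  refine (hF.iteratedDeriv_nonneg hΩ hA' c hc N
    (fun k i => (w k - c k) ^ (i : ℕ) / (i : ℕ).factorial * ξ k)).trans_eq ?_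
  refine Finset.sum_congr rfl fun k _ => Finset.sum_congr rfl fun l _ => ?_
  rw [Finset.sum_product, Finset.sum_range, Finset.sum_mul, Finset.sum_mul]
  refine Finset.sum_congr rfl fun i _ => ?_
  rw [Finset.sum_range, Finset.sum_mul, Finset.sum_mul]
  refine Finset.sum_congr rfl fun j _ => ?_
  simp only [map_mul, map_div₀, map_pow, Complex.conj_natCast]
  ring

/-! ### Taylor bounds, analyticity and off-diagonal estimates. -/

/-- A function that is analytic or has a pole at every point is analytic on a ball on which its
Taylor coefficients at the centre allow it. -/
theorem analyticAt_of_norm_iteratedDeriv_le {F : ℂ → ℂ}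
    (hF : ∀ z, AnalyticAt ℂ F z ∨ Tendsto (fun w => ‖F w‖) (𝓝[≠] z) atTop)
    {p : ℂ} (hp : AnalyticAt ℂ F p) {C ρ : ℝ} (hρ : 0 < ρ)
    (hC : ∀ n : ℕ, ‖iteratedDeriv n F p‖ ≤ C * n.factorial / ρ ^ n) :
    ∀ z ∈ Metric.ball p ρ, AnalyticAt ℂ F z := by
  lift ρ to NNReal using hρ.le
  set P := FormalMultilinearSeries.ofScalars ℂ (fun n => iteratedDeriv n F p / n.factorial) with hP
  have hser : HasFPowerSeriesAt F P p := hp.hasFPowerSeriesAt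
  have hrad : (ρ : ENNReal) ≤ P.radius := by
    refine P.le_radius_of_bound C fun n => ?_
    rw [hP, FormalMultilinearSeries.ofScalars_norm, norm_div, Complex.norm_natCast]
    have h1 : (0 : ℝ) < n.factorial := by exact_mod_cast n.factorial_pos
    have h2 : (0 : ℝ) < (ρ : ℝ) ^ n := by positivity
    calc _ ≤ C * n.factorial / (ρ : ℝ) ^ n / n.factorial * (ρ : ℝ) ^ n := by
          gcongr
          exact hC n
      _ = C := by field_simp
  have hball := P.hasFPowerSeriesOnBall ((ENNReal.coe_pos.mpr (by exact_mod_cast hρ)).trans_le hrad)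
  set g : ℂ → ℂ := fun z => P.sum (z - p) with hg
  have hgA : ∀ z ∈ Metric.ball p ρ, AnalyticAt ℂ g z := by
    intro z hz
    have h1 : AnalyticAt ℂ P.sum (z - p) := by
      refine hball.analyticAt_of_mem (Metric.eball_subset_eball hrad ?_)
      rw [Metric.eball_coe, mem_ball_iff_norm, sub_zero]
      exact mem_ball_iff_norm.mp hz
    exact AnalyticAt.fun_comp (g := P.sum) (f := fun z => z - p) h1 (by fun_prop)
  have hFg : F =ᶠ[𝓝 p] g := by
    obtain ⟨r, hr⟩ := hser
    have hb := Metric.eball_mem_nhds p hr.r_pos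
    filter_upwards [hb] with z hz
    have := hr.sum (y := z - p) (by simpa [edist_eq_enorm_sub] using hz)
    simpa [hg] using this
  -- The set of local agreement is relatively closed in the ball: at a limit point either the
  -- identity theorem applies, or F has a pole while agreeing frequently with the locally bounded g.
  have hsub : Metric.ball p (ρ : ℝ) ⊆ {z | F =ᶠ[𝓝 z] g} := by
    refine (convex_ball p (ρ : ℝ)).isPreconnected.subset_of_closure_inter_subset
      isOpen_setOfPred_eventually_nhds ⟨p, Metric.mem_ball_self hρ, hFg⟩ ?_
    rintro z ⟨hz, hzb⟩
    have hgz := hgA z hzb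
    by_contra hne
    have hfreq : ∃ᶠ w in 𝓝[≠] z, F w = g w := by
      have h1 : ∃ᶠ w in 𝓝 z, F =ᶠ[𝓝 w] g := mem_closure_iff_frequently.mp hz
      rw [frequently_nhdsWithin_iff]
      refine h1.mono fun w hw => ⟨hw.self_of_nhds, ?_⟩
      rintro rfl
      exact hne hw
    rcases hF z with h | h
    · exact hne ((h.frequently_eq_iff_eventually_eq hgz).mp hfreq)
    · have hbd : ∀ᶠ w in 𝓝[≠] z, ‖g w‖ < ‖g z‖ + 1 :=
        nhdsWithin_le_nhds (hgz.continuousAt.norm.eventually_lt_const (by linarith))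
      obtain ⟨w, hw, hw1, hw2⟩ := (hfreq.and_eventually
        (hbd.and (h.eventually_ge_atTop (‖g z‖ + 1)))).exists
      rw [hw] at hw2
      linarith
  intro z hz
  exact (hgA z hz).congr (hsub hz).symm

theorem PositiveDefiniteKernelOn.mono {F : ℂ → ℂ} {Ω Ω' : Set ℂ}
    (hF : PositiveDefiniteKernelOn F Ω) (h : Ω' ⊆ Ω) : PositiveDefiniteKernelOn F Ω' :=
  fun ι _ w hw ξ => hF ι w (fun k => h (hw k)) ξ

/-- The off-diagonal bound for a nonnegative sesquilinear form in two variables. -/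
theorem two_mul_norm_le_of_form_nonneg {A B C D : ℂ}
    (h : ∀ x y : ℂ, 0 ≤ A * x * conj x + B * x * conj y + (C * y * conj x + D * y * conj y))
    (t : ℝ) : 2 * t * ‖B‖ ≤ A.re + t ^ 2 * D.re := by
  have hA := (Complex.nonneg_iff.mp (h 1 0)).2
  have hD := (Complex.nonneg_iff.mp (h 0 1)).2
  have h1 := (Complex.nonneg_iff.mp (h 1 1)).2
  have h2 := (Complex.nonneg_iff.mp (h 1 Complex.I)).2
  simp at hA hD h1 h2
  have hC : C = conj B := Complex.ext (by simp; linarith) (by simp; linarith)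
  by_cases hB : B = 0
  · have h3 := (Complex.nonneg_iff.mp (h 1 t)).1
    subst hC
    simp [hB] at h3 ⊢
    nlinarith
  · have hn : (‖B‖ : ℂ) ≠ 0 := by simpa using hB
    -- This phase turns the cross terms into -2t‖B‖.
    have h3 := h 1 (-t * B / ‖B‖)
    have hBB : B * conj B = (‖B‖ : ℂ) ^ 2 := Complex.mul_conj' B
    have e : A * 1 * conj (1 : ℂ) + B * 1 * conj (-t * B / ‖B‖ : ℂ) +
        (C * (-t * B / ‖B‖) * conj (1 : ℂ) + D * (-t * B / ‖B‖) * conj (-t * B / ‖B‖ : ℂ)) =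
        A - 2 * t * ‖B‖ + t ^ 2 * D := by
      rw [hC]
      simp only [map_div₀, map_mul, map_neg, Complex.conj_ofReal, map_one]
      field_simp
      linear_combination (-2 * (‖B‖ : ℂ) * t + D * t ^ 2) * hBB
    rw [e] at h3
    have h4 := (Complex.nonneg_iff.mp h3).1
    have e2 : A - 2 * t * ‖B‖ + t ^ 2 * D =
        A - ((2 * t * ‖B‖ : ℝ) : ℂ) + ((t ^ 2 : ℝ) : ℂ) * D := by push_cast; ring
    rw [e2, Complex.add_re, Complex.sub_re, Complex.ofReal_re, Complex.re_ofReal_mul] at h4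
    linarith

/-- Test the jet form on vectors carrying the single order i at c and j at c'. The parameter t
balances derivatives of different orders. -/
theorem PositiveDefiniteKernelOn.two_mul_norm_iteratedDeriv_le {F : ℂ → ℂ} {Ω : Set ℂ}
    (hF : PositiveDefiniteKernelOn F Ω)
    (hΩ : ∀ c ∈ Ω, ∀ᶠ ε : ℝ in 𝓝 0, c + ε ∈ Ω)
    (hA : ∀ c ∈ Ω, ∀ c' ∈ Ω, AnalyticAt ℂ F (c + conj c'))
    {c c' : ℂ} (hc : c ∈ Ω) (hc' : c' ∈ Ω) (i j : ℕ) (t : ℝ) :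
    2 * t * ‖iteratedDeriv (i + j) F (c + conj c')‖ ≤
      (iteratedDeriv (i + i) F (c + conj c)).re +
        t ^ 2 * (iteratedDeriv (j + j) F (c' + conj c')).re := by
  refine two_mul_norm_le_of_form_nonneg
    (C := iteratedDeriv (j + i) F (c' + conj c)) (fun x y => ?_) t
  have h := hF.iteratedDeriv_nonneg hΩ hA ![c, c'] (by simp [Fin.forall_fin_two, hc, hc'])
    (i + j + 1) ![Pi.single ⟨i, by omega⟩ x, Pi.single ⟨j, by omega⟩ y]
  refine h.trans_eq ?_
  simp only [Fin.sum_univ_two, Matrix.cons_val_zero, Matrix.cons_val_one, Pi.single_apply,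
    apply_ite conj, map_zero, mul_ite, ite_mul, mul_zero, zero_mul, Finset.sum_ite_eq',
    Finset.mem_univ, if_true]

/-! ### Propagation along the real axis and into the strip. -/

/-- On the real axis the Taylor coefficients of a function analytic there are uniformly bounded. -/
theorem exists_uniform_taylor_bound {F : ℂ → ℂ} {α β : ℝ}
    (hA : ∀ s ∈ Set.Icc α β, AnalyticAt ℂ F (s : ℂ)) :
    ∃ δ > 0, ∃ M : ℝ, ∀ s ∈ Set.Icc α β, (∀ z ∈ Metric.ball (s : ℂ) δ, AnalyticAt ℂ F z) ∧
      ∀ n : ℕ, ‖iteratedDeriv n F s‖ ≤ M * n.factorial / δ ^ n := by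
  set K : Set ℂ := (fun s : ℝ => (s : ℂ)) '' Set.Icc α β with hK
  have hKc : IsCompact K := isCompact_Icc.image Complex.continuous_ofReal
  obtain ⟨δ, hδ, hsub⟩ := hKc.exists_cthickening_subset_open (isOpen_analyticAt ℂ F)
    (by rintro _ ⟨s, hs, rfl⟩; exact hA s hs)
  obtain ⟨M, hM⟩ := (hKc.cthickening (r := δ)).exists_bound_of_continuousOn (f := F)
    (fun z hz => (hsub hz).continuousAt.continuousWithinAt)
  have hball : ∀ s ∈ Set.Icc α β, Metric.closedBall (s : ℂ) δ ⊆ Metric.cthickening δ K :=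
    fun s hs => Metric.closedBall_subset_cthickening (Set.mem_image_of_mem _ hs) δ
  refine ⟨δ, hδ, M, fun s hs => ⟨fun z hz => hsub (hball s hs (Metric.ball_subset_closedBall hz)),
    fun n => ?_⟩⟩
  have := Complex.norm_iteratedDeriv_le_of_forall_mem_sphere_norm_le (f := F) (C := M) n hδ
    (DifferentiableOn.diffContOnCl (by
      rw [closure_ball _ hδ.ne']
      exact fun z hz => (hsub (hball s hs hz)).differentiableAt.differentiableWithinAt))
    (fun z hz => hM z (hball s hs (Metric.sphere_subset_closedBall hz)))
  rwa [mul_comm M]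

theorem eventually_add_ofReal_re_mem_Ioo {c : ℂ} {a b : ℝ} (h1 : a < c.re) (h2 : c.re < b) :
    ∀ᶠ ε : ℝ in 𝓝 0, a < (c + ε).re ∧ (c + ε).re < b := by
  have ht : Tendsto (fun ε : ℝ => (c + ε).re) (𝓝 0) (𝓝 c.re) := by
    have : Continuous fun ε : ℝ => (c + ε).re := by fun_prop
    simpa using this.tendsto 0
  exact (ht.eventually_const_lt h1).and (ht.eventually_lt_const h2)

/-- Propagation of positive definiteness along the real axis. -/
theorem PositiveDefiniteKernelOn.extend_real {F : ℂ → ℂ} {α β α₀ β₀ : ℝ}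
    (hA : ∀ s ∈ Set.Icc α β, AnalyticAt ℂ F (s : ℂ)) (hα : α ≤ α₀) (h₀ : α₀ < β₀) (hβ : β₀ ≤ β)
    (hF : PositiveDefiniteKernelOn F {w | w.im = 0 ∧ α₀ / 2 < w.re ∧ w.re < β₀ / 2}) :
    PositiveDefiniteKernelOn F {w | w.im = 0 ∧ α / 2 < w.re ∧ w.re < β / 2} := by
  obtain ⟨δ, hδ, _, hM⟩ := exists_uniform_taylor_bound hA
  set m := (α₀ + β₀) / 4 with hm
  set L := (β₀ - α₀) / 4 with hL
  have hLpos : 0 < L := by rw [hL]; linarith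
  -- The initial segment has centre m and half-length L; each step adds δ/2 at both ends, clipped to
  -- the target.
  have key : ∀ n : ℕ, PositiveDefiniteKernelOn F
      {w | w.im = 0 ∧ (α / 2 < w.re ∧ w.re < β / 2) ∧
        (m - (L + n * (δ / 2)) < w.re ∧ w.re < m + (L + n * (δ / 2)))} := by
    intro n
    induction n with
    | zero =>
      refine hF.mono ?_
      rintro w ⟨h1, h2, h3, h4⟩
      simp only [Nat.cast_zero, zero_mul, add_zero] at h3 h4
      exact ⟨h1, by linarith, by linarith⟩
    | succ n ih =>
      refine (ih.extend ?_ (half_pos hδ) ?_).mono ?_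
      · rintro c ⟨h1, ⟨h2, h3⟩, h4, h5⟩
        filter_upwards [eventually_add_ofReal_re_mem_Ioo h2 h3,
          eventually_add_ofReal_re_mem_Ioo h4 h5] with ε h6 h7
        exact ⟨by simpa using h1, h6, h7⟩
      · rintro c ⟨h1, ⟨h2, h3⟩, -⟩ c' ⟨h1', ⟨h2', h3'⟩, -⟩ z hz
        have e : c + conj c' = ((c.re + c'.re : ℝ) : ℂ) :=
          Complex.ext (by simp) (by simp [h1, h1'])
        rw [e, mul_div_cancel₀ _ (two_ne_zero' ℝ)] at hz
        exact (hM _ ⟨by linarith, by linarith⟩).1 z hz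
      · rintro w ⟨h1, ⟨h2, h3⟩, h4, h5⟩
        rw [Metric.mem_thickening_iff]
        push_cast at h4 h5
        set R := L + n * (δ / 2) with hR
        have hRpos : 0 < R := by positivity
        have hR' : L + ((n : ℝ) + 1) * (δ / 2) = R + δ / 2 := by rw [hR]; ring
        rw [hR'] at h4 h5
        have hpos : 0 < R + δ / 2 := by positivity
        -- Contraction towards m by θ maps the enlarged interval into the old one, moves points by
        -- less than δ/2, and respects the clipping by convexity.
        set θ := R / (R + δ / 2) with hθ
        have hθ0 : 0 < θ := by positivity
        have hθ1 : θ < 1 := by rw [hθ, div_lt_one hpos]; linarith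
        have hθR : θ * (R + δ / 2) = R := by rw [hθ]; field_simp
        refine ⟨((m + θ * (w.re - m) : ℝ) : ℂ), ⟨by simp, ⟨?_, ?_⟩, ?_, ?_⟩, ?_⟩
        · rw [Complex.ofReal_re]; nlinarith
        · rw [Complex.ofReal_re]; nlinarith
        · rw [Complex.ofReal_re]; nlinarith
        · rw [Complex.ofReal_re]; nlinarith
        · have e : w = (w.re : ℂ) := Complex.ext (by simp) (by simp [h1])
          rw [e, Complex.dist_eq, ← Complex.ofReal_sub, Complex.norm_real, Real.norm_eq_abs,
            Complex.ofReal_re, abs_lt]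
          constructor <;> nlinarith
  obtain ⟨n, hn⟩ := exists_nat_gt ((β - α) / (δ / 2))
  rw [div_lt_iff₀ (half_pos hδ)] at hn
  refine (key n).mono ?_
  rintro w ⟨h1, h2, h3⟩
  exact ⟨h1, ⟨h2, h3⟩, by linarith, by linarith⟩

/-- Scaling by n/(n+1) takes height at most (n+1)h to at most nh and moves the point by at most h,
giving the centre needed in the induction on height. -/
theorem dist_im_scale (z : ℂ) (n : ℕ) :
    dist z ⟨z.re, z.im * (n / (n + 1))⟩ = |z.im| / (n + 1) := by
  have hn : (0 : ℝ) < n + 1 := by positivity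
  have h := Complex.dist_of_re_eq (z := z) (w := ⟨z.re, z.im * (n / (n + 1))⟩) rfl
  have e : z.im - z.im * (n / (n + 1)) = z.im / (n + 1) := by
    field_simp
    ring
  rw [h, Real.dist_eq, e, abs_div, abs_of_pos hn]

/-- A meromorphic function whose kernel is positive definite on a real segment has no poles in the
strip over it, and its kernel is positive definite there. -/
theorem PositiveDefiniteKernelOn.extend_strip {F : ℂ → ℂ} {α β : ℝ}
    (hmero : ∀ z, AnalyticAt ℂ F z ∨ Tendsto (fun w => ‖F w‖) (𝓝[≠] z) atTop)
    (hA : ∀ s ∈ Set.Icc α β, AnalyticAt ℂ F (s : ℂ))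
    (hF : PositiveDefiniteKernelOn F {w | w.im = 0 ∧ α / 2 < w.re ∧ w.re < β / 2}) :
    (∀ z : ℂ, α < z.re → z.re < β → AnalyticAt ℂ F z) ∧
      PositiveDefiniteKernelOn F {w | α / 2 < w.re ∧ w.re < β / 2} := by
  obtain ⟨δ, hδ, M, hM⟩ := exists_uniform_taylor_bound hA
  -- Analyticity and positivity climb together; the kernel needs half the height because two
  -- arguments are added.
  have key : ∀ n : ℕ, (∀ z : ℂ, α < z.re → z.re < β → |z.im| ≤ n * (δ / 2) → AnalyticAt ℂ F z) ∧
      PositiveDefiniteKernelOn F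
        {w | (α / 2 < w.re ∧ w.re < β / 2) ∧ |w.im| ≤ n * (δ / 4)} := by
    intro n
    induction n with
    | zero =>
      refine ⟨fun z h1 h2 h3 => ?_, hF.mono ?_⟩
      · have h4 : z.im = 0 := by simpa using h3
        have e : z = (z.re : ℂ) := Complex.ext (by simp) (by simp [h4])
        rw [e]
        exact hA _ ⟨h1.le, h2.le⟩
      · rintro w ⟨h1, h2⟩
        exact ⟨by simpa using h2, h1⟩
    | succ n ih =>
      obtain ⟨ihA, ihF⟩ := ih
      have hopen : ∀ c ∈ {w : ℂ | (α / 2 < w.re ∧ w.re < β / 2) ∧ |w.im| ≤ n * (δ / 4)},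
          ∀ᶠ ε : ℝ in 𝓝 0,
            c + ε ∈ {w : ℂ | (α / 2 < w.re ∧ w.re < β / 2) ∧ |w.im| ≤ n * (δ / 4)} := by
        rintro c ⟨⟨h1, h2⟩, h3⟩
        filter_upwards [eventually_add_ofReal_re_mem_Ioo h1 h2] with ε h4
        exact ⟨h4, by simpa using h3⟩
      have hadd : ∀ c ∈ {w : ℂ | (α / 2 < w.re ∧ w.re < β / 2) ∧ |w.im| ≤ n * (δ / 4)},
          ∀ c' ∈ {w : ℂ | (α / 2 < w.re ∧ w.re < β / 2) ∧ |w.im| ≤ n * (δ / 4)},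
          α < (c + conj c').re ∧ (c + conj c').re < β ∧ |(c + conj c').im| ≤ n * (δ / 2) := by
        rintro c ⟨⟨h1, h2⟩, h3⟩ c' ⟨⟨h1', h2'⟩, h3'⟩
        rw [abs_le] at h3 h3' ⊢
        simp only [Complex.add_re, Complex.conj_re, Complex.add_im, Complex.conj_im]
        refine ⟨by linarith, by linarith, by linarith, by linarith⟩
      have hsum : ∀ c ∈ {w : ℂ | (α / 2 < w.re ∧ w.re < β / 2) ∧ |w.im| ≤ n * (δ / 4)},
          ∀ c' ∈ {w : ℂ | (α / 2 < w.re ∧ w.re < β / 2) ∧ |w.im| ≤ n * (δ / 4)},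
          AnalyticAt ℂ F (c + conj c') := fun c hc c' hc' =>
        ihA _ (hadd c hc c' hc').1 (hadd c hc c' hc').2.1 (hadd c hc c' hc').2.2
      have hball : ∀ p : ℂ, α < p.re → p.re < β → |p.im| ≤ n * (δ / 2) →
          ∀ z ∈ Metric.ball p δ, AnalyticAt ℂ F z := by
        intro p h1 h2 h3
        have hbound : ∀ k : ℕ, ‖iteratedDeriv k F (p.re : ℂ)‖ ≤ M * k.factorial / δ ^ k :=
          (hM p.re ⟨h1.le, h2.le⟩).2
        have hM0 : 0 ≤ M := by simpa using (norm_nonneg _).trans (hbound 0)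
        refine analyticAt_of_norm_iteratedDeriv_le hmero (ihA p h1 h2 h3) hδ (C := 2 * M)
          fun k => ?_
        have hbound' : ∀ k : ℕ, (iteratedDeriv k F (p.re : ℂ)).re ≤ M * k.factorial / δ ^ k :=
          fun k => (Complex.re_le_norm _).trans (hbound k)
        have hc : p / 2 ∈ {w : ℂ | (α / 2 < w.re ∧ w.re < β / 2) ∧ |w.im| ≤ n * (δ / 4)} := by
          refine ⟨⟨?_, ?_⟩, ?_⟩
          · simp; linarith
          · simp; linarith
          · simp [abs_div]; linarith
        have hc' : conj p / 2 ∈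
            {w : ℂ | (α / 2 < w.re ∧ w.re < β / 2) ∧ |w.im| ≤ n * (δ / 4)} := by
          refine ⟨⟨?_, ?_⟩, ?_⟩
          · simp; linarith
          · simp; linarith
          · simp [abs_div]; linarith
        have hconj : ∀ q : ℂ, conj (q / 2) = conj q / 2 := fun q => by
          rw [map_div₀, map_ofNat]
        have e1 : p / 2 + conj (conj p / 2) = p := by rw [hconj, Complex.conj_conj]; ring
        have e2 : p / 2 + conj (p / 2) = (p.re : ℂ) := by
          rw [hconj, ← add_div, Complex.add_conj]; push_cast; ring
        have e3 : conj p / 2 + conj (conj p / 2) = (p.re : ℂ) := by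
          rw [hconj, Complex.conj_conj, add_comm, ← add_div, Complex.add_conj]; push_cast; ring
        have hmin : ∀ (i j : ℕ) (t : ℝ), 2 * t * ‖iteratedDeriv (i + j) F p‖ ≤
            (iteratedDeriv (i + i) F (p.re : ℂ)).re +
              t ^ 2 * (iteratedDeriv (j + j) F (p.re : ℂ)).re := by
          intro i j t
          have := ihF.two_mul_norm_iteratedDeriv_le hopen hsum hc hc' i j t
          rwa [e1, e2, e3] at this
        rcases Nat.even_or_odd' k with ⟨i, rfl | rfl⟩
        · have h4 := hmin i i 1
          have h5 := hbound' (i + i)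
          rw [← two_mul] at h4 h5
          have h6 : 0 ≤ M * (2 * i).factorial / δ ^ (2 * i) := by positivity
          rw [mul_assoc 2 M, mul_div_assoc]
          linarith
        -- For odd order 2i + 1 = i + (i + 1), this weight brings the bound of order 2i + 2 below
        -- that of order 2i. The loss is at most a factor 2, whence the constant 2M.
        · set t := δ / (2 * i + 2) with ht
          have htpos : 0 < t := by positivity
          have h4 := hmin i (i + 1) t
          have h5 := hbound' (i + i)
          have h6 := hbound' (i + 1 + (i + 1))
          rw [show i + 1 + (i + 1) = 2 * i + 1 + 1 by ring] at h4 h6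
          rw [show i + (i + 1) = 2 * i + 1 by ring] at h4
          rw [← two_mul] at h4 h5
          have h7 : t ^ 2 * (iteratedDeriv (2 * i + 1 + 1) F (p.re : ℂ)).re ≤
              M * (2 * i).factorial / δ ^ (2 * i) := by
            refine (mul_le_mul_of_nonneg_left h6 (by positivity)).trans ?_
            rw [Nat.factorial_succ (2 * i + 1), Nat.factorial_succ (2 * i)]
            push_cast
            have : t ^ 2 * (M * ((2 * i + 1 + 1) * ((2 * i + 1) * (2 * i).factorial)) /
                δ ^ (2 * i + 1 + 1)) =
                (2 * i + 1) / (2 * i + 2) * (M * (2 * i).factorial / δ ^ (2 * i)) := by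
              rw [ht]
              field_simp
              ring
            rw [this]
            refine mul_le_of_le_one_left (by positivity) ?_
            rw [div_le_one (by positivity)]
            linarith
          have h8 : 2 * t * (2 * M * (2 * i + 1).factorial / δ ^ (2 * i + 1)) =
              2 * (2 * (2 * i + 1) / (2 * i + 2)) * (M * (2 * i).factorial / δ ^ (2 * i)) := by
            rw [ht, Nat.factorial_succ (2 * i)]
            push_cast
            field_simp
            ring
          have h9 : (1 : ℝ) ≤ 2 * (2 * i + 1) / (2 * i + 2) := by
            rw [le_div_iff₀ (by positivity)]
            have : (0 : ℝ) ≤ i := by positivity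
            linarith
          have h10 : 0 ≤ M * (2 * i).factorial / δ ^ (2 * i) := by positivity
          have h11 := mul_le_mul_of_nonneg_right h9 h10
          refine le_of_mul_le_mul_left (a := 2 * t) ?_ (by positivity)
          rw [h8, mul_assoc 2]
          linarith
      refine ⟨fun z h1 h2 h3 => ?_, (ihF.extend hopen (half_pos hδ) ?_).mono ?_⟩
      · push_cast at h3
        have hn : (0 : ℝ) < n + 1 := by positivity
        have h4 : |z.im| / (n + 1) ≤ δ / 2 := by
          rw [div_le_iff₀ hn]; linarith
        refine hball ⟨z.re, z.im * (n / (n + 1))⟩ h1 h2 ?_ z ?_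
        · have : |z.im * ((n : ℝ) / (n + 1))| = n * (|z.im| / (n + 1)) := by
            rw [abs_mul, abs_of_nonneg (by positivity : (0 : ℝ) ≤ n / (n + 1))]
            ring
          simp only [this]
          gcongr
        · rw [Metric.mem_ball, dist_im_scale]
          linarith
      · intro c hc c' hc' z hz
        rw [mul_div_cancel₀ _ (two_ne_zero' ℝ)] at hz
        exact hball _ (hadd c hc c' hc').1 (hadd c hc c' hc').2.1 (hadd c hc c' hc').2.2 z hz
      · rintro w ⟨h1, h3⟩
        push_cast at h3
        have hn : (0 : ℝ) < n + 1 := by positivity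
        have h4 : |w.im| / (n + 1) ≤ δ / 4 := by
          rw [div_le_iff₀ hn]; linarith
        refine Metric.mem_thickening_iff.mpr ⟨⟨w.re, w.im * (n / (n + 1))⟩, ⟨h1, ?_⟩, ?_⟩
        · have : |w.im * ((n : ℝ) / (n + 1))| = n * (|w.im| / (n + 1)) := by
            rw [abs_mul, abs_of_nonneg (by positivity : (0 : ℝ) ≤ n / (n + 1))]
            ring
          simp only [this]
          gcongr
        · rw [dist_im_scale]
          linarith
  constructor
  · intro z h1 h2
    obtain ⟨n, hn⟩ := exists_nat_gt (|z.im| / (δ / 2))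
    rw [div_lt_iff₀ (half_pos hδ)] at hn
    exact (key n).1 z h1 h2 hn.le
  · intro ι _ w hw ξ
    obtain ⟨n, hn⟩ := exists_nat_gt ((∑ k, |(w k).im|) / (δ / 4))
    rw [div_lt_iff₀ (by positivity)] at hn
    refine (key n).2 ι w (fun k => ⟨hw k, ?_⟩) ξ
    have := Finset.single_le_sum (f := fun k => |(w k).im|) (fun _ _ => abs_nonneg _)
      (Finset.mem_univ k)
    exact this.trans hn.le

/-! ### Excluding real poles. -/

/-- Unlike the bound on derivatives, this assumes no analyticity, so it can be used to exclude
poles. -/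
theorem PositiveDefiniteKernelOn.two_mul_norm_le {F : ℂ → ℂ} {Ω : Set ℂ}
    (hF : PositiveDefiniteKernelOn F Ω) {c c' : ℂ} (hc : c ∈ Ω) (hc' : c' ∈ Ω) :
    2 * ‖F (c + conj c')‖ ≤ (F (c + conj c)).re + (F (c' + conj c')).re := by
  have h := two_mul_norm_le_of_form_nonneg (A := F (c + conj c)) (B := F (c + conj c'))
    (C := F (c' + conj c)) (D := F (c' + conj c')) (fun x y => by
      have := hF (Fin 2) ![c, c'] (by simp [Fin.forall_fin_two, hc, hc']) ![x, y]
      simpa [Fin.sum_univ_two] using this) 1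
  simpa using h

/-- A positive definite kernel on a real segment excludes real poles. -/
theorem PositiveDefiniteKernelOn.analyticAt_ofReal {F : ℂ → ℂ} {α β : ℝ} (hm : Meromorphic F)
    (hmero : ∀ z, AnalyticAt ℂ F z ∨ Tendsto (fun w => ‖F w‖) (𝓝[≠] z) atTop)
    (hF : PositiveDefiniteKernelOn F {w | w.im = 0 ∧ α / 2 < w.re ∧ w.re < β / 2})
    {y : ℝ} (h1 : α < y) (h2 : y < β) : AnalyticAt ℂ F (y : ℂ) := by
  refine (hmero y).resolve_right fun hpole => ?_
  have hcast : Tendsto (fun m : ℝ => (m : ℂ)) (𝓝[≠] y) (𝓝[≠] (y : ℂ)) := by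
    refine tendsto_nhdsWithin_iff.mpr ⟨?_, ?_⟩
    · exact Complex.continuous_ofReal.continuousAt.mono_left nhdsWithin_le_nhds
    · filter_upwards [self_mem_nhdsWithin] with m hmy
      simpa using hmy
  have hev : ∀ᶠ m : ℝ in 𝓝[≠] y, AnalyticAt ℂ F m := hcast.eventually (hm y).eventually_analyticAt
  rw [eventually_nhdsWithin_iff, Metric.eventually_nhds_iff] at hev
  obtain ⟨ε, hε, hball⟩ := hev
  obtain ⟨ρ, hρ, hρ'⟩ := exists_between (lt_min hε (lt_min (sub_pos.mpr h1) (sub_pos.mpr h2)))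
  obtain ⟨hρε, hρ'⟩ := lt_min_iff.mp hρ'
  obtain ⟨hρα, hρβ⟩ := lt_min_iff.mp hρ'
  have hA : AnalyticAt ℂ F ((y + ρ : ℝ) : ℂ) := by
    refine hball ?_ ?_
    · rw [Real.dist_eq, add_sub_cancel_left, abs_of_pos hρ]
      exact hρε
    · simpa using hρ.ne'
  have hcont : Tendsto (fun m : ℝ =>
      (F ((m - (y - ρ) / 2 : ℝ) + conj ((m - (y - ρ) / 2 : ℝ) : ℂ))).re)
      (𝓝 y) (𝓝 (F ((y + ρ : ℝ) : ℂ)).re) := by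
    have e : ((y - (y - ρ) / 2 : ℝ) : ℂ) + conj ((y - (y - ρ) / 2 : ℝ) : ℂ) = ((y + ρ : ℝ) : ℂ) := by
      rw [Complex.conj_ofReal]
      push_cast
      ring
    have hg : Continuous fun m : ℝ =>
        ((m - (y - ρ) / 2 : ℝ) : ℂ) + conj ((m - (y - ρ) / 2 : ℝ) : ℂ) := by
      have := Complex.continuous_conj
      fun_prop
    have hg' := hg.tendsto y
    rw [e] at hg'
    exact (Complex.continuous_re.tendsto _).comp (hA.continuousAt.tendsto.comp hg')
  -- Split m = s + (m - s) with s fixed. As m tends to the pole y, the diagonal points are 2s = y -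
  -- ρ, fixed, and 2(m - s), tending to y + ρ where F is analytic, so the bound on ‖F m‖ stays
  -- finite.
  set s : ℂ := (((y - ρ) / 2 : ℝ) : ℂ) with hs
  have hlt : ∀ᶠ m : ℝ in 𝓝[≠] y,
      (F ((m - (y - ρ) / 2 : ℝ) + conj ((m - (y - ρ) / 2 : ℝ) : ℂ))).re <
        (F ((y + ρ : ℝ) : ℂ)).re + 1 :=
    nhdsWithin_le_nhds (hcont.eventually_lt_const (by linarith))
  have hnear : ∀ᶠ m : ℝ in 𝓝[≠] y, y - ρ / 4 < m ∧ m < y + (β - y - ρ) / 2 := by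
    refine nhdsWithin_le_nhds ?_
    exact (eventually_gt_nhds (by linarith)).and (eventually_lt_nhds (by linarith))
  have hlarge := (hpole.comp hcast).eventually_gt_atTop
    (((F (s + conj s)).re + ((F ((y + ρ : ℝ) : ℂ)).re + 1)) / 2)
  obtain ⟨m, h3, ⟨h4, h5⟩, h6⟩ := (hlt.and (hnear.and hlarge)).exists
  have hb := hF.two_mul_norm_le (c := s) (c' := ((m - (y - ρ) / 2 : ℝ) : ℂ))
    ⟨by simp [hs], by rw [hs, Complex.ofReal_re]; linarith,
      by rw [hs, Complex.ofReal_re]; linarith⟩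
    ⟨by simp, by rw [Complex.ofReal_re]; linarith, by rw [Complex.ofReal_re]; linarith⟩
  have e : s + conj ((m - (y - ρ) / 2 : ℝ) : ℂ) = (m : ℂ) := by
    rw [Complex.conj_ofReal, hs]
    push_cast
    ring
  rw [e] at hb
  simp only [Function.comp_apply] at h6
  linarith

/-! ### Rotation between f and F. -/

theorem analyticAt_comp_I_mul_iff {f : ℂ → ℂ} {z : ℂ} :
    AnalyticAt ℂ (fun w => f (Complex.I * w)) z ↔ AnalyticAt ℂ f (Complex.I * z) := by
  constructor
  · intro h
    have e : f = fun w => (fun w => f (Complex.I * w)) (-Complex.I * w) := by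
      funext w
      simp [← mul_assoc]
    rw [e]
    refine AnalyticAt.fun_comp (g := fun w => f (Complex.I * w)) (f := fun w => -Complex.I * w)
      ?_ (by fun_prop)
    simpa [← mul_assoc] using h
  · intro h
    exact AnalyticAt.fun_comp (g := f) (f := fun w => Complex.I * w) h (by fun_prop)

theorem IsMeromorphicFunction.isPoleAt_of_not_analyticAt {f : ℂ → ℂ}
    (hf : IsMeromorphicFunction f) {p : ℂ} (h : ¬ AnalyticAt ℂ f p) : IsPoleAt f p :=
  by_contra fun hp => h (hf.2 p hp)

theorem IsMeromorphicFunction.meromorphic_comp_I_mul {f : ℂ → ℂ} (hf : IsMeromorphicFunction f) :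
    Meromorphic fun w => f (Complex.I * w) := fun z =>
  (hf.1 (Complex.I * z)).comp_analyticAt (g := fun w => Complex.I * w) (by fun_prop)

theorem IsMeromorphicFunction.analyticAt_or_tendsto {f : ℂ → ℂ} (hf : IsMeromorphicFunction f)
    (z : ℂ) : AnalyticAt ℂ (fun w => f (Complex.I * w)) z ∨
      Tendsto (fun w => ‖f (Complex.I * w)‖) (𝓝[≠] z) atTop := by
  by_cases h : IsPoleAt f (Complex.I * z)
  · right
    have h1 := tendsto_norm_cobounded_atTop.comp (tendsto_cobounded_of_meromorphicOrderAt_neg h.2)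
    refine h1.comp (tendsto_nhdsWithin_iff.mpr ⟨?_, ?_⟩)
    · exact (continuous_const_mul Complex.I).continuousAt.mono_left nhdsWithin_le_nhds
    · filter_upwards [self_mem_nhdsWithin] with w hw
      simpa using hw
  · exact Or.inl (analyticAt_comp_I_mul_iff.mpr (hf.2 _ h))

/-- Conjugation is invisible at real points, and halving the segment keeps all pairwise sums in the
interval. -/
theorem CoPositiveDefiniteOn.positiveDefiniteKernelOn {f : ℂ → ℂ} {a b : EReal}
    (hG : CoPositiveDefiniteOn (fun y : ℝ => f (Complex.I * (y : ℂ))) (realInterval a b))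
    {α β : ℝ} (hα : a ≤ (α : EReal)) (hβ : (β : EReal) ≤ b) :
    PositiveDefiniteKernelOn (fun w => f (Complex.I * w))
      {w | w.im = 0 ∧ α / 2 < w.re ∧ w.re < β / 2} := by
  intro ι _ w hw ξ
  have e := Fintype.equivFin ι
  have h := hG (Fintype.card ι) (fun k => (w (e.symm k)).re) (fun k l => by
    obtain ⟨-, h1, h2⟩ := hw (e.symm k)
    obtain ⟨-, h3, h4⟩ := hw (e.symm l)
    exact ⟨hα.trans_lt (EReal.coe_lt_coe_iff.mpr (by linarith)),
      (EReal.coe_lt_coe_iff.mpr (by linarith)).trans_le hβ⟩) (fun k => ξ (e.symm k))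
  refine h.trans_eq ?_
  rw [e.symm.sum_comp (fun k => ∑ l, f (Complex.I * (((w k).re + (w (e.symm l)).re : ℝ) : ℂ)) *
    ξ k * conj (ξ (e.symm l)))]
  refine Finset.sum_congr rfl fun k _ => ?_
  rw [e.symm.sum_comp (fun l => f (Complex.I * (((w k).re + (w l).re : ℝ) : ℂ)) *
    ξ k * conj (ξ l))]
  refine Finset.sum_congr rfl fun l _ => ?_
  have : (((w k).re + (w l).re : ℝ) : ℂ) = w k + conj (w l) :=
    Complex.ext (by simp) (by simp [(hw k).1, (hw l).1])
  rw [this]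

/-! ### The maximal strip. -/

theorem mainTheorem4 (f : ℂ → ℂ) (hf : IsMeromorphicFunction f) (a b : EReal) (hab : a < b)
    (hG : CoPositiveDefiniteOn (fun y : ℝ => f (Complex.I * (y : ℂ))) (realInterval a b)) :
    ∃ c d : EReal,
      IsMaximalHolomorphicStrip f a b c d ∧
      PositiveDefiniteOn f (horizontalStrip c d) ∧
      (∀ r : ℝ, c = (r : EReal) → IsPoleAt f (Complex.I * (r : ℂ))) ∧
      (∀ r : ℝ, d = (r : EReal) → IsPoleAt f (Complex.I * (r : ℂ))) := by
  have hm := hf.meromorphic_comp_I_mul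
  have hmero := hf.analyticAt_or_tendsto
  have hinner : ∀ y : ℝ, a < y → (y : EReal) < b → AnalyticAt ℂ f (Complex.I * y) := by
    intro y h1 h2
    obtain ⟨α, hα1, hα2⟩ := EReal.lt_iff_exists_real_btwn.mp h1
    obtain ⟨β, hβ1, hβ2⟩ := EReal.lt_iff_exists_real_btwn.mp h2
    exact analyticAt_comp_I_mul_iff.mp
      ((hG.positiveDefiniteKernelOn hα1.le hβ2.le).analyticAt_ofReal hm hmero
        (EReal.coe_lt_coe_iff.mp hα2) (EReal.coe_lt_coe_iff.mp hβ1))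
  obtain ⟨y₀, hay, hyb⟩ := EReal.lt_iff_exists_real_btwn.mp hab
  have hopen : IsOpen {y : ℝ | AnalyticAt ℂ f (Complex.I * y)} :=
    (isOpen_analyticAt ℂ f).preimage (by fun_prop : Continuous fun y : ℝ => Complex.I * (y : ℂ))
  -- Only singularities on the axis are recorded. With none on one side, the supremum or infimum of
  -- the empty set gives -∞ or +∞.
  set c : EReal := sSup {x | ∃ r : ℝ, x = r ∧ r < y₀ ∧ ¬ AnalyticAt ℂ f (Complex.I * r)} with hc
  set d : EReal := sInf {x | ∃ r : ℝ, x = r ∧ y₀ < r ∧ ¬ AnalyticAt ℂ f (Complex.I * r)} with hd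
  have hca : c ≤ a := by
    refine sSup_le ?_
    rintro _ ⟨r, rfl, hr, hrA⟩
    by_contra! h
    exact hrA (hinner r h ((EReal.coe_lt_coe_iff.mpr hr).trans hyb))
  have hbd : b ≤ d := by
    refine le_sInf ?_
    rintro _ ⟨r, rfl, hr, hrA⟩
    by_contra! h
    exact hrA (hinner r (hay.trans (EReal.coe_lt_coe_iff.mpr hr)) h)
  have haxis : ∀ y : ℝ, c < y → (y : EReal) < d → AnalyticAt ℂ f (Complex.I * y) := by
    intro y h1 h2
    by_contra h
    rcases lt_trichotomy y y₀ with h3 | h3 | h3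
    · exact absurd h1 (not_lt.mpr (le_sSup ⟨y, rfl, h3, h⟩))
    · exact h (h3 ▸ hinner y₀ hay hyb)
    · exact absurd h2 (not_lt.mpr (sInf_le ⟨y, rfl, h3, h⟩))
  have hcpole : ∀ r : ℝ, c = (r : EReal) → IsPoleAt f (Complex.I * (r : ℂ)) := by
    intro r hr
    refine hf.isPoleAt_of_not_analyticAt fun hA => ?_
    -- Analyticity at ir would persist on (r - ε, r], where the supremum forces a singularity.
    obtain ⟨ε, hε, hsub⟩ := Metric.isOpen_iff.mp hopen r hA
    have h1 : ((r - ε : ℝ) : EReal) < c := by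
      rw [hr]; exact EReal.coe_lt_coe_iff.mpr (by linarith)
    obtain ⟨_, ⟨s, rfl, hs1, hs2⟩, hs3⟩ := lt_sSup_iff.mp h1
    have h2 : (s : EReal) ≤ r := hr ▸ le_sSup ⟨s, rfl, hs1, hs2⟩
    rw [EReal.coe_le_coe_iff] at h2
    rw [EReal.coe_lt_coe_iff] at hs3
    exact hs2 (hsub (by rw [Metric.mem_ball, Real.dist_eq, abs_lt]; constructor <;> linarith))
  have hdpole : ∀ r : ℝ, d = (r : EReal) → IsPoleAt f (Complex.I * (r : ℂ)) := by
    intro r hr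
    refine hf.isPoleAt_of_not_analyticAt fun hA => ?_
    obtain ⟨ε, hε, hsub⟩ := Metric.isOpen_iff.mp hopen r hA
    have h1 : d < ((r + ε : ℝ) : EReal) := by
      rw [hr]; exact EReal.coe_lt_coe_iff.mpr (by linarith)
    obtain ⟨_, ⟨s, rfl, hs1, hs2⟩, hs3⟩ := sInf_lt_iff.mp h1
    have h2 : (r : EReal) ≤ s := hr ▸ sInf_le ⟨s, rfl, hs1, hs2⟩
    rw [EReal.coe_le_coe_iff] at h2
    rw [EReal.coe_lt_coe_iff] at hs3
    exact hs2 (hsub (by rw [Metric.mem_ball, Real.dist_eq, abs_lt]; constructor <;> linarith))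
  -- The uniform bounds need a compact segment, so the work is done on [α, β] inside (c, d), chosen
  -- to contain both [α₀, β₀] and the prescribed u, v.
  have hcore : ∀ u v : ℝ, c < u → (v : EReal) < d → ∃ α β : ℝ, α < u ∧ v < β ∧
      (∀ z : ℂ, α < z.re → z.re < β → AnalyticAt ℂ (fun w => f (Complex.I * w)) z) ∧
      PositiveDefiniteKernelOn (fun w => f (Complex.I * w))
        {w | α / 2 < w.re ∧ w.re < β / 2} := by
    intro u v hu hv
    obtain ⟨α₀, hα₀, hα₀'⟩ := EReal.lt_iff_exists_real_btwn.mp hay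
    obtain ⟨β₀, hβ₀, hβ₀'⟩ := EReal.lt_iff_exists_real_btwn.mp hyb
    obtain ⟨α, hα, hα'⟩ := EReal.lt_iff_exists_real_btwn.mp (lt_min hu (hca.trans_lt hα₀))
    obtain ⟨β, hβ, hβ'⟩ := EReal.lt_iff_exists_real_btwn.mp (max_lt hv (hβ₀'.trans_le hbd))
    obtain ⟨hα1, hα2⟩ := lt_min_iff.mp hα'
    obtain ⟨hβ1, hβ2⟩ := max_lt_iff.mp hβ
    rw [EReal.coe_lt_coe_iff] at hα₀' hβ₀ hα1 hα2 hβ1 hβ2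
    have hA : ∀ s ∈ Set.Icc α β, AnalyticAt ℂ (fun w => f (Complex.I * w)) (s : ℂ) :=
      fun s hs => analyticAt_comp_I_mul_iff.mpr
        (haxis s (hα.trans_le (EReal.coe_le_coe_iff.mpr hs.1))
          ((EReal.coe_le_coe_iff.mpr hs.2).trans_lt hβ'))
    have hreal := (hG.positiveDefiniteKernelOn hα₀.le hβ₀'.le).extend_real hA hα2.le
      (hα₀'.trans hβ₀) hβ2.le
    exact ⟨α, β, hα1, hβ1, hreal.extend_strip hmero hA⟩
  refine ⟨c, d, ⟨fun z hz => ⟨hca.trans_lt hz.1, hz.2.trans_le hbd⟩, ?_, ?_⟩, ?_, hcpole, hdpole⟩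
  · rintro z ⟨h1, h2⟩
    obtain ⟨α, β, h3, h4, hA, -⟩ := hcore z.im z.im h1 h2
    have h := hA (-Complex.I * z) (by simpa using h3) (by simpa using h4)
    rw [analyticAt_comp_I_mul_iff] at h
    have e : Complex.I * (-Complex.I * z) = z := by simp [← mul_assoc]
    rw [e] at h
    exact h.differentiableAt.differentiableWithinAt
  · intro c' d' hsub hdiff
    have hy₀ : Complex.I * (y₀ : ℂ) ∈ horizontalStrip c' d' :=
      hsub ⟨by simpa using hay, by simpa using hyb⟩
    have hy₀c : c' < (y₀ : EReal) := by simpa using hy₀.1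
    have hy₀d : (y₀ : EReal) < d' := by simpa using hy₀.2
    have hstrip : IsOpen (horizontalStrip c' d') := by
      have hcont : Continuous fun z : ℂ => (z.im : EReal) :=
        continuous_coe_real_ereal.comp Complex.continuous_im
      exact (isOpen_lt continuous_const hcont).inter (isOpen_lt hcont continuous_const)
    have han : ∀ r : ℝ, c' < r → (r : EReal) < d' → AnalyticAt ℂ f (Complex.I * r) := fun r h1 h2 =>
      hdiff.analyticAt (hstrip.mem_nhds ⟨by simpa using h1, by simpa using h2⟩)
    have hcc : c ≤ c' := by
      refine sSup_le ?_
      rintro _ ⟨r, rfl, hr, hrA⟩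
      by_contra! h
      exact hrA (han r h ((EReal.coe_lt_coe_iff.mpr hr).trans hy₀d))
    have hdd : d' ≤ d := by
      refine le_sInf ?_
      rintro _ ⟨r, rfl, hr, hrA⟩
      by_contra! h
      exact hrA (han r (hy₀c.trans (EReal.coe_lt_coe_iff.mpr hr)) h)
    exact fun z hz => ⟨hcc.trans_lt hz.1, hz.2.trans_le hdd⟩
  · intro n z hz ξ
    -- The lowest and highest of the finitely many points place them all in one strip from `hcore`;
    -- an empty family has no extremes.
    rcases isEmpty_or_nonempty (Fin n) with hn | hn
    · simp
    · obtain ⟨k₀, hk₀⟩ := Finite.exists_min fun k => (z k).im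
      obtain ⟨k₁, hk₁⟩ := Finite.exists_max fun k => (z k).im
      have h2 : ∀ k, (z k - conj (z k)).im = 2 * (z k).im := fun k => by
        simp only [Complex.sub_im, Complex.conj_im]
        ring
      have hu := (hz k₀ k₀).1
      have hv := (hz k₁ k₁).2
      rw [h2] at hu hv
      obtain ⟨α, β, h3, h4, -, hK⟩ := hcore _ _ hu hv
      have h := hK (Fin n) (fun k => -Complex.I * z k) (fun k => by
        refine ⟨?_, ?_⟩
        · have := hk₀ k
          simp
          linarith
        · have := hk₁ k
          simp
          linarith) ξ
      refine h.trans_eq ?_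
      refine Finset.sum_congr rfl fun k _ => Finset.sum_congr rfl fun l _ => ?_
      have e : Complex.I * (-Complex.I * z k + conj (-Complex.I * z l)) = z k - conj (z l) := by
        simp only [map_mul, map_neg, Complex.conj_I]
        linear_combination (conj (z l) - z k) * Complex.I_mul_I
      simp only [e]
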